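/- Let $n\ge 0$ and $r\ge 2$ be integers and let $A$ be an $n\times n$ real matrix with nonnegative entries which is $r$-potent, i.e. $A^r=A$. Call an $n\times n$ real matrix $A$ decomposable if there are an $n\times n$ permutation matrix $P$ and an integer $k$ with $0<k<n$ such that $$P^{-1}AP=\begin{pmatrix} B & C\\ 0 & D\end{pmatrix}$$ with $B$ of size $k\times k$ and $D$ of size $(n-k)\times(n-k)$. Then: (1) If $\operatorname{rank}(A)>r-1$, then $A$ is decomposable. (2) Suppose $n\ge 2$ and $r\ge 3$. If $\operatorname{rank}(A)\le r-1$, $A$ is singular, and each of the matrices $A^2,A^3,\ldots,A^{r-1}$ has at least one diagonal entry equal to zero, then $A$ is decomposable. -/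

import Mathlib

/-- A real square matrix `A` of order `n` is decomposable if there is a permutation matrix `P`
such that `P⁻¹ * A * P` is block upper triangular with (nonempty) square diagonal blocks, of
orders `k` and `n - k` with `0 < k < n`: the lower left block, in the rows with index at least `k`
and the columns with index less than `k` (counted from `0`), vanishes. -/
def Matrix.IsDecomposable {n : ℕ} (A : Matrix (Fin n) (Fin n) ℝ) : Prop :=
  ∃ (σ : Equiv.Perm (Fin n)) (k : ℕ), 0 < k ∧ k < n ∧
    ∀ i j : Fin n, k ≤ (i : ℕ) → (j : ℕ) < k →
      ((σ.permMatrix ℝ)⁻¹ * A * σ.permMatrix ℝ) i j = 0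

namespace Matrix

variable {n : ℕ} {A E : Matrix (Fin n) (Fin n) ℝ}

/-! Suppose `A` is indecomposable, so its digraph is strongly connected, and put `p = r - 1`, `E = A
^ p`, an idempotent. Powers of `E` collapse to `E`, so a walk whose length is a positive multiple of
`p` gives a positive entry of `E` (`pow_apply_pos_of_modEq`). Label each vertex by the length mod
`p` of a walk from a base vertex: equal labels give positive entries of `E`, hence proportional
columns, so `rank E ≤ p`, and `A = E * A` gives (1). For (2), a closed walk at `i` traversed `p`
times gives `E i i > 0`. -/

/-- A nonempty proper set of indices which is not entered from outside exhibits a decomposition. -/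
theorem isDecomposable_of_forall_eq_zero (S : Finset (Fin n)) (hne : S.Nonempty)
    (hproper : S ≠ Finset.univ) (hS : ∀ i j, i ∉ S → j ∈ S → A i j = 0) :
    A.IsDecomposable := by
  have hlt : S.card < n := by
    simpa using Finset.card_lt_univ_of_notMem
      (by simpa [Finset.eq_univ_iff_forall] using hproper : ∃ x, x ∉ S).choose_spec
  have hcard : Fintype.card {i : Fin n // (i : ℕ) < S.card} = Fintype.card {i // i ∈ S} := by
    rw [Fintype.card_coe, Fintype.card_subtype]
    have : (Finset.univ.filter fun i : Fin n => (i : ℕ) < S.card)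
        = Finset.Iio (⟨S.card, hlt⟩ : Fin n) := by
      ext i; simp [Fin.lt_def]
    rw [this, Fin.card_Iio]
  let e := Fintype.equivOfCardEq hcard
  refine ⟨e.extendSubtype⁻¹, S.card, hne.card_pos, hlt, fun i j hi hj => ?_⟩
  have hinv : ((e.extendSubtype⁻¹ : Equiv.Perm (Fin n)).permMatrix ℝ)⁻¹
      = (e.extendSubtype).permMatrix ℝ := by
    apply Matrix.inv_eq_left_inv
    rw [← Matrix.permMatrix_mul]
    simp
  rw [hinv, Equiv.Perm.permMatrix, Equiv.Perm.permMatrix, PEquiv.mul_toMatrix_toPEquiv,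
    PEquiv.toMatrix_toPEquiv_mul]
  exact hS _ _ (e.extendSubtype_not_mem i (by simpa using hi)) (e.extendSubtype_mem j hj)

theorem mul_apply_pos {B : Matrix (Fin n) (Fin n) ℝ} (hA : ∀ i j, 0 ≤ A i j)
    (hB : ∀ i j, 0 ≤ B i j) {i j k : Fin n} (hij : 0 < A i j) (hjk : 0 < B j k) :
    0 < (A * B) i k := by
  rw [mul_apply]
  exact Finset.sum_pos' (fun l _ => mul_nonneg (hA _ _) (hB _ _))
    ⟨j, Finset.mem_univ _, mul_pos hij hjk⟩

theorem pow_apply_nonneg_of_nonneg (hA : ∀ i j, 0 ≤ A i j) (m : ℕ) (i j : Fin n) :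
    0 ≤ (A ^ m) i j := by
  induction m generalizing j with
  | zero => rw [pow_zero, one_apply]; split_ifs <;> norm_num
  | succ m ih =>
    rw [pow_succ, mul_apply]
    exact Finset.sum_nonneg fun k _ => mul_nonneg (ih k) (hA k j)

theorem pow_add_apply_pos (hA : ∀ i j, 0 ≤ A i j) {a b : ℕ} {i j k : Fin n}
    (hij : 0 < (A ^ a) i j) (hjk : 0 < (A ^ b) j k) : 0 < (A ^ (a + b)) i k := by
  rw [pow_add]
  exact mul_apply_pos (pow_apply_nonneg_of_nonneg hA a) (pow_apply_nonneg_of_nonneg hA b) hij hjk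

theorem pow_mul_apply_self_pos (hA : ∀ i j, 0 ≤ A i j) {a : ℕ} {i : Fin n}
    (hi : 0 < (A ^ a) i i) (q : ℕ) : 0 < (A ^ (a * q)) i i := by
  induction q with
  | zero => simp
  | succ q ih => rw [Nat.mul_succ]; exact pow_add_apply_pos hA ih hi

/-- The directed graph of an indecomposable nonnegative matrix is strongly connected. -/
theorem exists_pow_apply_pos_of_not_isDecomposable (hA : ∀ i j, 0 ≤ A i j)
    (hdec : ¬ A.IsDecomposable) (hn : 2 ≤ n) (i j : Fin n) :
    ∃ m, 1 ≤ m ∧ 0 < (A ^ m) i j := by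
  classical
  have key : ∀ t i : Fin n, ∃ m, 0 < (A ^ m) i t := by
    intro t
    by_contra hcon
    refine hdec (isDecomposable_of_forall_eq_zero
      (Finset.univ.filter fun i => ∃ m, 0 < (A ^ m) i t) ⟨t, ?_⟩ ?_ fun i j hi hj => ?_)
    · simpa using ⟨0, by simp⟩
    · simpa [Finset.eq_univ_iff_forall] using hcon
    · simp only [Finset.mem_filter, Finset.mem_univ, true_and] at hi hj
      obtain ⟨m, hm⟩ := hj
      by_contra hne
      have hij : 0 < (A ^ 1) i j := by
        rw [pow_one]; exact lt_of_le_of_ne (hA i j) (Ne.symm hne)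
      exact hi ⟨1 + m, pow_add_apply_pos hA hij hm⟩
  have off : ∀ i j : Fin n, i ≠ j → ∃ m, 1 ≤ m ∧ 0 < (A ^ m) i j := by
    intro i j hij
    obtain ⟨m, hm⟩ := key j i
    refine ⟨m, Nat.one_le_iff_ne_zero.2 ?_, hm⟩
    rintro rfl
    simp [hij] at hm
  by_cases hij : i = j
  -- A second vertex is needed for a closed walk of positive length: the `1 × 1` zero matrix is
  -- indecomposable.
  · subst hij
    have : Nontrivial (Fin n) := Fin.nontrivial_iff_two_le.2 hn
    obtain ⟨k, hk⟩ := exists_ne i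
    obtain ⟨a, ha, hik⟩ := off i k hk.symm
    obtain ⟨b, _, hki⟩ := off k i hk
    exact ⟨a + b, by omega, pow_add_apply_pos hA hik hki⟩
  · exact off i j hij

/-- If `A ^ p` is idempotent, a closed walk at `i` and a walk from `i` to `j` whose lengths agree
modulo `p` make the entry `(i, j)` of `A ^ p` positive. -/
theorem pow_apply_pos_of_modEq (hA : ∀ i j, 0 ≤ A i j) {p : ℕ} (hp : 1 ≤ p)
    (hidem : IsIdempotentElem (A ^ p)) {a b : ℕ} (hb : 1 ≤ b) (hab : a ≡ b [MOD p])
    {i j : Fin n} (hi : 0 < (A ^ a) i i) (hij : 0 < (A ^ b) i j) : 0 < (A ^ p) i j := by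
  -- Going round the closed walk `p - 1` times before the other walk makes the length `≡ a * p ≡ 0`
  -- mod `p`.
  have hpos := pow_add_apply_pos hA (pow_mul_apply_self_pos hA hi (p - 1)) hij
  have hdvd : p ∣ a * (p - 1) + b := by
    rw [← Nat.modEq_zero_iff_dvd]
    calc a * (p - 1) + b ≡ a * (p - 1) + a [MOD p] := hab.symm.add_left _
      _ = a * p := by rw [← Nat.mul_succ, Nat.succ_eq_add_one, Nat.sub_add_cancel hp]
      _ ≡ 0 [MOD p] := Nat.modEq_zero_iff_dvd.2 (dvd_mul_left p a)
  obtain ⟨q, hq⟩ := hdvd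
  have hq0 : q ≠ 0 := by rintro rfl; omega
  rwa [hq, pow_mul, hidem.pow_eq hq0] at hpos

/-- In a nonnegative idempotent matrix with symmetric support, columns which meet in the support
are proportional. -/
theorem exists_col_eq_mul_of_isIdempotentElem (hE : ∀ i j, 0 ≤ E i j)
    (hidem : IsIdempotentElem E) (hsymm : ∀ i j, 0 < E i j → 0 < E j i) {j k : Fin n}
    (hjk : 0 < E j k) : ∃ c : ℝ, ∀ i, E i j = c * E i k := by
  have htrans : ∀ a b c, 0 < E a b → 0 < E b c → 0 < E a c := fun a b c hab hbc => by
    rw [← hidem.eq]; exact mul_apply_pos hE hE hab hbc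
  -- With `c` the least ratio, column `j` minus `c` times column `k` is nonnegative, fixed by `E`,
  -- and zero at `i₀`. Row `i₀` is positive on the support of column `k`, so the difference vanishes
  -- there.
  obtain ⟨i₀, hi₀, hmin⟩ := Finset.exists_min_image
    (Finset.univ.filter fun i => 0 < E i k) (fun i => E i j / E i k) ⟨j, by simpa using hjk⟩
  simp only [Finset.mem_filter, Finset.mem_univ, true_and] at hi₀ hmin
  set c := E i₀ j / E i₀ k
  have hzero : ∀ i, ¬ 0 < E i k → E i j = 0 ∧ E i k = 0 := fun i hi =>
    ⟨le_antisymm (not_lt.1 fun h => hi (htrans _ _ _ h hjk)) (hE _ _),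
      le_antisymm (not_lt.1 hi) (hE _ _)⟩
  have hnonneg : ∀ i, 0 ≤ E i j - c * E i k := by
    intro i
    by_cases hi : 0 < E i k
    · exact sub_nonneg.2 ((le_div_iff₀ hi).1 (hmin i hi))
    · simp [hzero i hi]
  have hsum : ∑ l, E i₀ l * (E l j - c * E l k) = 0 := by
    have h : ∀ m, ∑ l, E i₀ l * E l m = E i₀ m := fun m => by
      rw [← mul_apply, hidem.eq]
    calc ∑ l, E i₀ l * (E l j - c * E l k)
        = ∑ l, E i₀ l * E l j - c * ∑ l, E i₀ l * E l k := by
          rw [Finset.mul_sum, ← Finset.sum_sub_distrib]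
          exact Finset.sum_congr rfl fun l _ => by ring
      _ = 0 := by rw [h, h, div_mul_cancel₀ _ hi₀.ne', sub_self]
  refine ⟨c, fun i => ?_⟩
  by_cases hi : 0 < E i k
  · have hterm := (Finset.sum_eq_zero_iff_of_nonneg fun l _ =>
      mul_nonneg (hE i₀ l) (hnonneg l)).1 hsum i (Finset.mem_univ i)
    have hpos : 0 < E i₀ i := htrans _ _ _ hi₀ (hsymm _ _ hi)
    exact sub_eq_zero.1 ((mul_eq_zero.1 hterm).resolve_left hpos.ne')
  · simp [hzero i hi]

/-- If a labelling of the columns by `p` labels is such that equally labelled columns are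
proportional, then the rank is at most `p`. -/
theorem rank_le_of_forall_exists_col_eq_mul {p : ℕ} (label : Fin n → Fin p)
    (h : ∀ j k, label j = label k → ∃ c : ℝ, ∀ i, E i j = c * E i k) : E.rank ≤ p := by
  classical
  rcases isEmpty_or_nonempty (Fin n) with hemp | hne
  · rw [Subsingleton.elim E 0, rank_zero]
    exact Nat.zero_le p
  have hg : ∀ j, label j = label (Function.invFun label (label j)) := fun j =>
    (Function.invFun_eq ⟨j, rfl⟩).symm
  choose c hc using fun j => h j _ (hg j)
  have hfac : E = (of fun i l => E i (Function.invFun label l) : Matrix (Fin n) (Fin p) ℝ) *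
      (of fun l j => if l = label j then c j else 0 : Matrix (Fin p) (Fin n) ℝ) := by
    ext i j
    simp [mul_apply, hc j i, mul_comm]
  rw [hfac]
  exact (rank_mul_le_left _ _).trans (rank_le_width _)

theorem isIdempotentElem_pow_sub_one_of_pow_eq {r : ℕ} (hr : 2 ≤ r) (h : A ^ r = A) :
    IsIdempotentElem (A ^ (r - 1)) := by
  obtain ⟨q, rfl⟩ := Nat.exists_eq_add_of_le' hr
  change A ^ (q + 1) * A ^ (q + 1) = A ^ (q + 1)
  rw [← pow_add, show q + 1 + (q + 1) = q + 2 + q by omega, pow_add, h, ← pow_succ']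

/-- An `r`-potent nonnegative matrix which is not decomposable has rank at most `r - 1`. -/
theorem rank_le_sub_one_of_not_isDecomposable {r : ℕ} (hr : 2 ≤ r) (hA : ∀ i j, 0 ≤ A i j)
    (hpot : A ^ r = A) (hdec : ¬ A.IsDecomposable) : A.rank ≤ r - 1 := by
  rcases Nat.lt_or_ge n 2 with hn | hn
  · exact (A.rank_le_width).trans (by omega)
  obtain ⟨p, hp, rfl⟩ : ∃ p, 1 ≤ p ∧ r = p + 1 := ⟨r - 1, by omega, by omega⟩
  have hidem : IsIdempotentElem (A ^ p) := isIdempotentElem_pow_sub_one_of_pow_eq hr hpot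
  have hconn := exists_pow_apply_pos_of_not_isDecomposable hA hdec hn
  have hsymm : ∀ i j, 0 < (A ^ p) i j → 0 < (A ^ p) j i := fun i j hij => by
    obtain ⟨s, hs, hji⟩ := hconn j i
    exact pow_apply_pos_of_modEq hA hp hidem hs (by simp [Nat.ModEq])
      (pow_add_apply_pos hA hji hij) hji
  choose m _ hm using hconn ⟨0, by omega⟩
  have hrank : (A ^ p).rank ≤ p := by
    refine rank_le_of_forall_exists_col_eq_mul
      (fun j => (⟨m j % p, Nat.mod_lt _ hp⟩ : Fin p)) fun j k hjk => ?_
    -- Through the base vertex, one return walk of length `s` yields both a closed walk at `j` and a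
    -- walk from `j` to `k`, congruent mod `p`.
    obtain ⟨s, hs, hj⟩ := hconn j ⟨0, by omega⟩
    have hmod : m j ≡ m k [MOD p] := congrArg Fin.val hjk
    exact exists_col_eq_mul_of_isIdempotentElem (pow_apply_nonneg_of_nonneg hA p) hidem hsymm
      (pow_apply_pos_of_modEq hA hp hidem (by omega) (hmod.add_left s)
        (pow_add_apply_pos hA hj (hm j)) (pow_add_apply_pos hA hj (hm k)))
  calc A.rank = (A ^ p * A).rank := by rw [← pow_succ, hpot]
    _ ≤ (A ^ p).rank := rank_mul_le_left _ _
    _ ≤ p := hrank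

/-- If `A` is nonnegative, indecomposable and `r`-potent, then `A ^ (r - 1)` has positive
diagonal. -/
theorem pow_sub_one_apply_self_pos {r : ℕ} (hr : 2 ≤ r) (hn : 2 ≤ n) (hA : ∀ i j, 0 ≤ A i j)
    (hpot : A ^ r = A) (hdec : ¬ A.IsDecomposable) (i : Fin n) : 0 < (A ^ (r - 1)) i i := by
  obtain ⟨m, hm, hi⟩ := exists_pow_apply_pos_of_not_isDecomposable hA hdec hn i i
  exact pow_apply_pos_of_modEq hA (by omega) (isIdempotentElem_pow_sub_one_of_pow_eq hr hpot)
    hm rfl hi hi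

end Matrix

theorem mainTheorem1 (n r : ℕ) (hr : 2 ≤ r) (A : Matrix (Fin n) (Fin n) ℝ)
    (hnonneg : ∀ i j, 0 ≤ A i j) (hpotent : A ^ r = A) :
    (r - 1 < A.rank → A.IsDecomposable) ∧
    (2 ≤ n → 3 ≤ r → A.rank ≤ r - 1 → A.det = 0 →
      (∀ k : ℕ, 2 ≤ k → k ≤ r - 1 → ∃ i, (A ^ k) i i = 0) → A.IsDecomposable) := by
  refine ⟨fun hrank => ?_, fun hn hr3 _ _ hdiag => ?_⟩
  · by_contra hdec
    exact hrank.not_ge (Matrix.rank_le_sub_one_of_not_isDecomposable hr hnonneg hpotent hdec)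
  · by_contra hdec
    obtain ⟨i, hi⟩ := hdiag (r - 1) (by omega) le_rfl
    exact (Matrix.pow_sub_one_apply_self_pos hr hn hnonneg hpotent hdec i).ne' hi
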